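/- **Setting.** Let $n\ge 1$ parties $P_0,\dots,P_{n-1}$ share residues modulo an RSA modulus $N$ (a product of two distinct odd primes) additively: $[x]=(x_0,\dots,x_{n-1})\in\mathbb Z_N^n$ with $\sum_i x_i=x$. "A fresh sharing of $a$" means a uniformly random vector with sum $a$. Residues are read as signed integers of least absolute value. Let $k\ge 1$ be the bit length and $\kappa\ge 0$ the security parameter, and assume that $N$ has room for the masked value, $2^{k+\kappa}+2^k\le N+1$. An admissible input is a sharing $[x]$ of an integer $-2^{k-1}\le x<2^{k-1}$. **Functionalities.** $\mathcal F_{GEZ}$ receives the shares of $[x]$, computes $s=1$ if $x\ge 0$ and $s=0$ otherwise, and sends the parties a fresh sharing of $s$. $\mathcal F_{RndBit}$ outputs a fresh sharing of a uniform bit. $\mathcal F_{PRndInt}(\ell)$ outputs a fresh sharing of a uniform integer in $[0,2^\ell)$. $\mathcal F_{BitLTC}(a,([b_{m-1}],\dots,[b_0]))$ outputs a fresh sharing of the bit $a<\sum_j 2^j b_j$. **Protocol $\mathrm{GEZ}$ on $([x],k)$.** 1. Call $\mathcal F_{RndBit}$ $k$ times in parallel to get $[r_0],\dots,[r_{k-1}]$,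 and put $[r']=\sum_{j=0}^{k-2}2^j[r_j]$. 2. Call $[r'']\leftarrow\mathcal F_{PRndInt}(\kappa+1)$. 3. Open $c=2^{k-1}r''+r'+2^{k-1}+x$ and put $c'=c \bmod 2^{k-1}$, where $c$ is represented in $\{0,\dots,N-1\}$. 4. Call $[u]\leftarrow\mathcal F_{BitLTC}(c',([r_{k-2}],\dots,[r_0]))$. 5. Put $[x']=c'-[r']+2^{k-1}[u]$. 6. Output $[s]=1+([x]-[x'])\cdot 2^{-(k-1)} \bmod N$. Here public constants are added to the share of $P_0$. **Adversarial model.** The adversary is malicious, static, computationally unbounded and rushing, and corrupts any set $C$ of at most $n-1$ parties. Security is universally composable security with abort: an environment chooses the admissible input sharing, interacts with the adversary arbitrarily and adaptively, reads the outputs of the honest parties, and finally outputs a bit. All sharings are authenticated: in an opening or in a call to a functionality the corrupted parties may contribute arbitrary shares, but the honest parties abort if the reconstructed value differs from the authentic value of that sharing. The adversary receives the corrupted parties' shares from the functionalities, and the published honest shares in an opening, before its next move, and may make the honest parties abort at any moment before they obtain their outputs. The same rules (authenticated input, abort also after seeing the corrupted output shares) hold for the simulator with $\mathcal F_{GEZ}$.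 **Proposition.** In the $(\mathcal F_{RndBit},\mathcal F_{PRndInt},\mathcal F_{BitLTC})$-hybrid model the following hold. (Correctness.) For every admissible input $[x]$, the vector of output shares of $\mathrm{GEZ}$, when all parties follow the protocol, has exactly the distribution of the output of $\mathcal F_{GEZ}$; in particular it is always a sharing of the bit $[x\ge 0]$. (Security.) $\mathrm{GEZ}$ securely realizes $\mathcal F_{GEZ}$ with statistical security $2^{-\kappa}$: for every $C\subsetneq\{P_0,\dots,P_{n-1}\}$ and every adversary $\mathcal A$ corrupting $C$ in the execution of $\mathrm{GEZ}$ there is a simulator $\mathcal S$ interacting with $\mathcal F_{GEZ}$ such that for every environment $\mathcal Z$ the probabilities that $\mathcal Z$ outputs $1$ in the two executions differ by at most $2^{-\kappa}$. -/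

import Mathlib

noncomputable section

/-! ## Interactive execution: environments, adversaries, simulators

All machines are probabilistic, stateful and computationally unbounded. -/

/-- A terminating randomized program that returns an element of `α` and may, on the way, send
messages in `Q` to some machine, which answers each of them by an element of `R`. -/
inductive Prog (Q R α : Type) : Type 1
  | ret (a : α) : Prog Q R α
  | sample {β : Type} (d : PMF β) (next : β → Prog Q R α) : Prog Q R α
  | query (q : Q) (next : R → Prog Q R α) : Prog Q R α

/-- Run a program against a stateful machine with transition function `step`. -/
def Prog.run {Q R α S : Type} (step : S → Q → PMF (R × S)) : Prog Q R α → S → PMF (α × S)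
  | .ret a, s => PMF.pure (a, s)
  | .sample d next, s => d.bind fun b => (next b).run step s
  | .query q next, s => (step s q).bind fun p => (next p.1).run step p.2

/-- A system with two ports. Through the port `env` the environment gives the inputs of the
parties and reads the outputs of the honest parties; through the port `adv` the adversary (or the
simulator) plays the corrupted parties and schedules the execution. -/
structure World (EIn EOut AIn AOut : Type) where
  State : Type
  init : State
  env : State → EIn → PMF (EOut × State)
  adv : State → AIn → PMF (AOut × State)

/-- An adversary (or a simulator) for worlds with adversary port `AIn`, `AOut`. It is activated by
messages `ZIn` from the environment; on each activation it may interact with the world, and then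
it reports an element of `ZOut` to the environment. -/
structure Adversary (AIn AOut ZIn ZOut : Type) where
  State : Type
  init : PMF State
  act : State → ZIn → Prog AIn AOut (ZOut × State)

/-- The environment: it talks in any order, adaptively, to the parties and to the adversary, and
finally outputs a bit. -/
inductive Environment (EIn EOut ZIn ZOut : Type) : Type 1
  | halt (guess : Bool) : Environment EIn EOut ZIn ZOut
  | sample {β : Type} (d : PMF β) (next : β → Environment EIn EOut ZIn ZOut) :
      Environment EIn EOut ZIn ZOut
  | callParties (q : EIn) (next : EOut → Environment EIn EOut ZIn ZOut) :
      Environment EIn EOut ZIn ZOut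
  | callAdversary (q : ZIn) (next : ZOut → Environment EIn EOut ZIn ZOut) :
      Environment EIn EOut ZIn ZOut

section Execution

variable {EIn EOut AIn AOut ZIn ZOut : Type}

/-- The output bit of the environment in the world `W` with the adversary `A`, started in the
states `w` and `a`. -/
def Environment.runFrom (W : World EIn EOut AIn AOut) (A : Adversary AIn AOut ZIn ZOut) :
    Environment EIn EOut ZIn ZOut → W.State → A.State → PMF Bool
  | .halt guess, _, _ => PMF.pure guess
  | .sample d next, w, a => d.bind fun b => (next b).runFrom W A w a
  | .callParties q next, w, a => (W.env w q).bind fun p => (next p.1).runFrom W A p.2 a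
  | .callAdversary q next, w, a =>
      ((A.act a q).run W.adv w).bind fun p => (next p.1.1).runFrom W A p.2 p.1.2

/-- The output bit of the environment `Z` after an execution in the world `W` with `A`. -/
def execution (W : World EIn EOut AIn AOut) (A : Adversary AIn AOut ZIn ZOut)
    (Z : Environment EIn EOut ZIn ZOut) : PMF Bool :=
  A.init.bind fun a => Z.runFrom W A W.init a

end Execution

/-- Universally composable realization with statistical error `ε`: for every adversary in the world
`real` there is a simulator in the world `ideal` such that no environment distinguishes the two
executions with advantage more than `ε`. -/
def UCRealizes {EIn EOut AIn AOut AIn' AOut' : Type}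
    (real : World EIn EOut AIn AOut) (ideal : World EIn EOut AIn' AOut') (ε : ℝ) : Prop :=
  ∀ (ZIn ZOut : Type) (A : Adversary AIn AOut ZIn ZOut),
    ∃ S : Adversary AIn' AOut' ZIn ZOut, ∀ Z : Environment EIn EOut ZIn ZOut,
      |(execution real A Z true).toReal - (execution ideal S Z true).toReal| ≤ ε

/-! ## Additive secret sharing modulo `N` and the functionalities -/

/-- An RSA modulus: a product of two distinct odd primes. -/
def IsRSAModulus (N : ℕ) : Prop :=
  ∃ p q : ℕ, p.Prime ∧ q.Prime ∧ p ≠ q ∧ Odd p ∧ Odd q ∧ N = p * q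

/-- A vector of additive shares: the share of the party `i` is the `i`-th coordinate. -/
abbrev Sharing (n N : ℕ) : Type := Fin n → ZMod N

section Functionalities

variable {n N : ℕ}

/-- The value that is shared. -/
def reconstruct (v : Sharing n N) : ZMod N := ∑ i, v i

variable [NeZero n] [NeZero N]

lemma sharings_nonempty (a : ZMod N) :
    (Finset.univ.filter fun v : Sharing n N => reconstruct v = a).Nonempty := by
  refine ⟨Pi.single 0 a, ?_⟩
  rw [Finset.mem_filter]
  exact ⟨Finset.mem_univ _, by simp [reconstruct]⟩

/-- A uniformly random sharing of `a`. -/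
def share (a : ZMod N) : PMF (Sharing n N) :=
  PMF.uniformOfFinset (Finset.univ.filter fun v : Sharing n N => reconstruct v = a)
    (sharings_nonempty a)

/-- The results of `m` independent calls. -/
def parallel {α : Type} (d : PMF α) : (m : ℕ) → PMF (Fin m → α)
  | 0 => PMF.pure Fin.elim0
  | m + 1 => d.bind fun a => (parallel d m).bind fun f => PMF.pure (Fin.cons a f)

/-- Random bit generation: a sharing of a uniform bit. -/
def fRndBit : PMF (Sharing n N) :=
  (PMF.uniformOfFintype Bool).bind fun b => share (if b then 1 else 0)

/-- Random integer generation: a sharing of a uniform integer of `l` bits. -/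
def fPRndInt (l : ℕ) : PMF (Sharing n N) :=
  (PMF.uniformOfFinset (Finset.range (2 ^ l)) ⟨0, by simp⟩).bind fun r => share (r : ZMod N)

/-- Comparison of the public integer `a` with the integer `b` whose bits are shared by `y`: a
sharing of the bit `a < b`. -/
def fBitLTC {m : ℕ} (a : ℕ) (y : Fin m → Sharing n N) : PMF (Sharing n N) :=
  share (if a < ∑ j : Fin m, 2 ^ (j : ℕ) * (reconstruct (y j)).val then 1 else 0)

/-- Comparison with zero: a sharing of the bit `x ≥ 0`, where residues modulo `N` are read as
integers of least absolute value. -/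
def fGEZ (x : Sharing n N) : PMF (Sharing n N) :=
  share (if 0 ≤ (reconstruct x).valMinAbs then 1 else 0)

end Functionalities

/-- The inputs of the comparison: sharings of a signed integer of `k` bits. -/
abbrev SignedSharing (n N k : ℕ) : Type :=
  {x : Sharing n N // -(2 : ℤ) ^ (k - 1) ≤ (reconstruct x).valMinAbs ∧
    (reconstruct x).valMinAbs < (2 : ℤ) ^ (k - 1)}

/-! ## The comparison protocol

The local computations of the party `i` use only its own shares and public values. A public
constant is added to a sharing by adding it to the share of the party `0`. -/

section Protocol

variable {n N k : ℕ} [NeZero n]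

/-- The share of the public constant `a` that the party `i` uses. -/
def constShare (a : ZMod N) (i : Fin n) : ZMod N := if i = 0 then a else 0

/-- The bits `0, …, k - 2` among the bits `0, …, k - 1`. -/
def lowBits {α : Type} (r : Fin k → α) : Fin (k - 1) → α :=
  fun j => r (Fin.castLE (Nat.sub_le k 1) j)

/-- The share of `r' = ∑ j ≤ k - 2, 2 ^ j * r j`. -/
def lowShare (r : Fin k → ZMod N) : ZMod N := ∑ j : Fin (k - 1), 2 ^ (j : ℕ) * lowBits r j

/-- The share of `2 ^ (k - 1) * r'' + r' + 2 ^ (k - 1) + x` that the party `i` publishes. -/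
def maskShare (i : Fin n) (x : ZMod N) (r : Fin k → ZMod N) (r'' : ZMod N) : ZMod N :=
  2 ^ (k - 1) * r'' + lowShare r + constShare (2 ^ (k - 1)) i + x

/-- `c' = c mod 2 ^ (k - 1)`, for the representative of `c` in `0, …, N - 1`. -/
def lowPart (k : ℕ) (c : ZMod N) : ℕ := c.val % 2 ^ (k - 1)

/-- The output share `1 + (x - x') * 2 ^ (-(k - 1))`, where `x' = c' - r' + 2 ^ (k - 1) * u`. -/
def outShare (i : Fin n) (x : ZMod N) (r : Fin k → ZMod N) (c : ZMod N) (u : ZMod N) : ZMod N :=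
  let x' := constShare (lowPart k c : ZMod N) i - lowShare r + 2 ^ (k - 1) * u
  constShare 1 i + (x - x') * ((2 : ZMod N) ^ (k - 1))⁻¹

/-- The sharing of the masked value. -/
def maskSharing (x : Sharing n N) (r : Fin k → Sharing n N) (r'' : Sharing n N) : Sharing n N :=
  fun i => maskShare i (x i) (fun j => r j i) (r'' i)

/-- The sharing of the output. -/
def outSharing (x : Sharing n N) (r : Fin k → Sharing n N) (c : ZMod N) (u : Sharing n N) :
    Sharing n N :=
  fun i => outShare i (x i) (fun j => r j i) c (u i)

variable [NeZero N]

/-- The output shares of the protocol when all parties follow it. -/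
def gezProtocol (κ k : ℕ) (x : Sharing n N) : PMF (Sharing n N) :=
  (parallel fRndBit k).bind fun r =>
  (fPRndInt (κ + 1)).bind fun r'' =>
  let c := reconstruct (maskSharing x r r'')
  (fBitLTC (lowPart k c) (lowBits r)).bind fun u =>
  PMF.pure (outSharing x r c u)

end Protocol

/-! ## The two worlds

The set `C` of corrupted parties is fixed. Sharings are authenticated: whenever the corrupted
parties contribute shares to an opening or to a functionality, the honest parties abort if the
reconstructed value differs from the authentic value of the sharing. The adversary sees the
shares of the corrupted parties, and in an opening the published shares of the honest parties,
before it makes its next move, and it may stop the execution at each moment before delivery. -/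

section Worlds

variable {n N : ℕ}

/-- Shares of the corrupted parties. -/
abbrev CorruptShares (N : ℕ) (C : Finset (Fin n)) : Type := {i // i ∈ C} → ZMod N

/-- Shares of the honest parties. -/
abbrev HonestShares (N : ℕ) (C : Finset (Fin n)) : Type := {i // i ∉ C} → ZMod N

def corruptPart (C : Finset (Fin n)) (v : Sharing n N) : CorruptShares N C := fun i => v i

def honestPart (C : Finset (Fin n)) (v : Sharing n N) : HonestShares N C := fun i => v i

/-- The shares that are contributed when the honest parties use `v` and the corrupted ones `e`. -/
def contributed {C : Finset (Fin n)} (v : Sharing n N) (e : CorruptShares N C) : Sharing n N :=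
  fun i => if h : i ∈ C then e ⟨i, h⟩ else v i

/-- The check of an authenticated sharing `v` against the contribution `e` of the corrupted
parties. -/
def authentic {C : Finset (Fin n)} (v : Sharing n N) (e : CorruptShares N C) : Prop :=
  reconstruct (contributed v e) = reconstruct v

/-- What the environment sends to the parties: the input sharing, or a request for the output. -/
inductive PartyIn (n N k : ℕ) : Type
  | input (x : SignedSharing n N k)
  | readOutput

/-- What the environment receives from the honest parties. -/
inductive PartyOut (N : ℕ) (C : Finset (Fin n)) : Type
  | ack
  | noOutput
  | abort
  | output (s : HonestShares N C)

/-! ### The ideal world: the parties call the comparison functionality -/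

inductive IdealState (n N k : ℕ) : Type
  | idle
  | ready (x : SignedSharing n N k)
  | computed (s : Sharing n N)
  | finished (s : Sharing n N)
  | aborted

inductive IdealMsg (N : ℕ) (C : Finset (Fin n)) : Type
  /-- read the input shares of the corrupted parties -/
  | readInput
  /-- the corrupted parties send these shares to the functionality -/
  | submit (e : CorruptShares N C)
  | deliver
  | abort

inductive IdealReply (N : ℕ) (C : Finset (Fin n)) : Type
  | refused
  | ack
  | aborted
  | shares (v : CorruptShares N C)

open Classical in
/-- The ideal functionality for the comparison, with authenticated input and with abort. -/
def idealWorld (k : ℕ) [NeZero n] [NeZero N] (C : Finset (Fin n)) :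
    World (PartyIn n N k) (PartyOut N C) (IdealMsg N C) (IdealReply N C) where
  State := IdealState n N k
  init := .idle
  env
    | .idle, .input x => PMF.pure (.ack, .ready x)
    | st, .input _ => PMF.pure (.ack, st)
    | .finished s, .readOutput => PMF.pure (.output (honestPart C s), .finished s)
    | .aborted, .readOutput => PMF.pure (.abort, .aborted)
    | st, .readOutput => PMF.pure (.noOutput, st)
  adv
    | .ready x, .readInput => PMF.pure (.shares (corruptPart C x.1), .ready x)
    | .ready x, .submit e =>
        if authentic x.1 e then
          (fGEZ (contributed x.1 e)).bind fun s =>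
            PMF.pure (.shares (corruptPart C s), .computed s)
        else PMF.pure (.aborted, .aborted)
    | .computed s, .deliver => PMF.pure (.ack, .finished s)
    | .ready _, .abort => PMF.pure (.aborted, .aborted)
    | .computed _, .abort => PMF.pure (.aborted, .aborted)
    | st, _ => PMF.pure (.refused, st)

/-! ### The hybrid world: the parties run the protocol -/

inductive HybridState (n N k : ℕ) : Type
  | idle
  | ready (x : SignedSharing n N k)
  /-- the shared random bits have been generated -/
  | bits (x : SignedSharing n N k) (r : Fin k → Sharing n N)
  /-- the shared random integer has been generated -/
  | masked (x : SignedSharing n N k) (r : Fin k → Sharing n N) (r'' : Sharing n N)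
  /-- the honest parties have published their shares of the masked value -/
  | opening (x : SignedSharing n N k) (r : Fin k → Sharing n N) (r'' : Sharing n N)
  /-- the masked value is public -/
  | opened (x : SignedSharing n N k) (r : Fin k → Sharing n N) (c : ZMod N)
  /-- the comparison of the public value with the shared bits has been made -/
  | compared (x : SignedSharing n N k) (r : Fin k → Sharing n N) (c : ZMod N) (u : Sharing n N)
  | finished (s : Sharing n N)
  | aborted

inductive HybridMsg (N k : ℕ) (C : Finset (Fin n)) : Type
  /-- read the input shares of the corrupted parties -/
  | readInput
  /-- all parties call the random bit functionality `k` times in parallel -/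
  | callRndBit
  /-- all parties call the random integer functionality -/
  | callPRndInt
  /-- the honest parties publish their shares of the masked value -/
  | openMask
  /-- the corrupted parties publish these shares of the masked value -/
  | publish (e : CorruptShares N C)
  /-- all parties call the bit comparison, the corrupted ones with these shares -/
  | callBitLTC (e : Fin (k - 1) → CorruptShares N C)
  /-- the honest parties compute and output their shares -/
  | deliver
  | abort

inductive HybridReply (N k : ℕ) (C : Finset (Fin n)) : Type
  | refused
  | ack
  | aborted
  | shares (v : CorruptShares N C)
  | bitShares (v : Fin k → CorruptShares N C)
  | published (v : HonestShares N C)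

open Classical in
/-- The execution of the protocol with security parameter `κ` on inputs of `k` bits, with ideal
random bits, random integers and bit comparison. -/
def hybridWorld (κ k : ℕ) [NeZero n] [NeZero N] (C : Finset (Fin n)) :
    World (PartyIn n N k) (PartyOut N C) (HybridMsg N k C) (HybridReply N k C) where
  State := HybridState n N k
  init := .idle
  env
    | .idle, .input x => PMF.pure (.ack, .ready x)
    | st, .input _ => PMF.pure (.ack, st)
    | .finished s, .readOutput => PMF.pure (.output (honestPart C s), .finished s)
    | .aborted, .readOutput => PMF.pure (.abort, .aborted)
    | st, .readOutput => PMF.pure (.noOutput, st)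
  adv
    | .ready x, .readInput => PMF.pure (.shares (corruptPart C x.1), .ready x)
    | .ready x, .callRndBit =>
        (parallel fRndBit k).bind fun r =>
          PMF.pure (.bitShares (fun j => corruptPart C (r j)), .bits x r)
    | .bits x r, .callPRndInt =>
        (fPRndInt (κ + 1)).bind fun r'' =>
          PMF.pure (.shares (corruptPart C r''), .masked x r r'')
    | .masked x r r'', .openMask =>
        PMF.pure (.published (honestPart C (maskSharing x.1 r r'')), .opening x r r'')
    | .opening x r r'', .publish e =>
        if authentic (maskSharing x.1 r r'') e then
          PMF.pure (.ack, .opened x r (reconstruct (contributed (maskSharing x.1 r r'') e)))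
        else PMF.pure (.aborted, .aborted)
    | .opened x r c, .callBitLTC e =>
        if ∀ j, authentic (lowBits r j) (e j) then
          (fBitLTC (lowPart k c) (fun j => contributed (lowBits r j) (e j))).bind fun u =>
            PMF.pure (.shares (corruptPart C u), .compared x r c u)
        else PMF.pure (.aborted, .aborted)
    | .compared x r c u, .deliver => PMF.pure (.ack, .finished (outSharing x.1 r c u))
    | .idle, .abort => PMF.pure (.refused, .idle)
    | .finished s, .abort => PMF.pure (.refused, .finished s)
    | _, .abort => PMF.pure (.aborted, .aborted)
    | st, _ => PMF.pure (.refused, st)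

end Worlds

end

/-! Put y = x + 2^(k-1), an integer in [0, 2^k). The size bound keeps r' + 2^(k-1) r'' + y below N,
so c' is (r' + y) mod 2^(k-1), the bit u is the carry out of the low part, x' is the low part of y,
and 1 + (x - x') / 2^(k-1) is the top bit of y, which is the sign of x
(`outSharing_sub_comparisonBit`). As 2^(k-1) is invertible modulo the odd N, the output vector is A
- u with A fixed before the last call. Since u is a fresh sharing, so is the output, whatever the
masks are (`map_outSharing_share`). This gives correctness.

For security, fix an honest party h. A fresh sharing is a uniform vector with the share of h
corrected (`share_eq_map_complete`), so corrupted shares can be drawn before the shared value. In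
the opening, a shift of the shares of r'' absorbs the honest input shares, and r' + 2^(k-1) r'' is
uniform on [0, 2^(k+κ)). Adding y raises the expectation of a function with values in [0, 1] by at
most y / 2^(k+κ) ≤ 2^(-κ) (`expect_mask_le`). This is the only loss. Afterwards the simulation is
exact: authentication checks depend on corrupted shares only, and s = A - u converts corrupted
output shares into corrupted shares of u.

`ApproxSimulation` lifts this to adaptive environments. Its relation holds a law of the real state,
so that randomness not yet seen stays unsampled, together with the error still to be spent. -/

open scoped ENNReal

noncomputable section

/-! ## Expectations of nonnegative functions -/

/-- The expectation of a nonnegative function. -/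
def PMF.expect {α : Type} (p : PMF α) (f : α → ℝ≥0∞) : ℝ≥0∞ := ∑' a, p a * f a

namespace PMF

variable {α β : Type}

lemma bind_apply_eq_expect (p : PMF α) (f : α → PMF β) (b : β) :
    (p.bind f) b = p.expect fun a => f a b := rfl

@[simp] lemma expect_pure (a : α) (f : α → ℝ≥0∞) : (PMF.pure a).expect f = f a := by
  unfold expect
  rw [tsum_eq_single a]
  · simp [PMF.pure_apply]
  · intro b hb
    simp [PMF.pure_apply, hb]

@[simp] lemma expect_bind (p : PMF α) (d : α → PMF β) (f : β → ℝ≥0∞) :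
    (p.bind d).expect f = p.expect fun a => (d a).expect f := by
  simp only [expect, PMF.bind_apply, ← ENNReal.tsum_mul_left, ← ENNReal.tsum_mul_right]
  rw [ENNReal.tsum_comm]
  simp only [mul_assoc]

@[simp] lemma expect_map (p : PMF α) (m : α → β) (f : β → ℝ≥0∞) :
    (p.map m).expect f = p.expect fun a => f (m a) := by
  simp [PMF.map]

lemma expect_mono (p : PMF α) {f g : α → ℝ≥0∞} (h : ∀ a, f a ≤ g a) :
    p.expect f ≤ p.expect g :=
  ENNReal.tsum_le_tsum fun a => mul_le_mul_right (h a) _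

lemma expect_congr_support (p : PMF α) {f g : α → ℝ≥0∞} (h : ∀ a ∈ p.support, f a = g a) :
    p.expect f = p.expect g := by
  refine tsum_congr fun a => ?_
  by_cases ha : p a = 0
  · simp [ha]
  · rw [h a ((p.mem_support_iff a).2 ha)]

lemma expect_mono_support (p : PMF α) {f g : α → ℝ≥0∞} (h : ∀ a ∈ p.support, f a ≤ g a) :
    p.expect f ≤ p.expect g := by
  refine ENNReal.tsum_le_tsum fun a => ?_
  by_cases ha : p a = 0
  · simp [ha]
  · exact mul_le_mul_right (h a ((p.mem_support_iff a).2 ha)) _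

@[simp] lemma expect_const (p : PMF α) (c : ℝ≥0∞) : (p.expect fun _ => c) = c := by
  simp [expect, ENNReal.tsum_mul_right, p.tsum_coe]

lemma expect_add (p : PMF α) (f g : α → ℝ≥0∞) :
    (p.expect fun a => f a + g a) = p.expect f + p.expect g := by
  simp [expect, mul_add, ENNReal.tsum_add]

/-- Randomness common to both executions can be fixed without increasing the error. -/
lemma expect_le_expect_add (p : PMF α) {f g : α → ℝ≥0∞} {c : ℝ≥0∞}
    (h : ∀ a, f a ≤ g a + c) : p.expect f ≤ p.expect g + c :=
  (p.expect_mono h).trans (by rw [expect_add, expect_const])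

lemma expect_le_one (p : PMF α) {f : α → ℝ≥0∞} (h : ∀ a, f a ≤ 1) : p.expect f ≤ 1 :=
  (p.expect_mono h).trans (by simp)

lemma expect_comm (p : PMF α) (q : PMF β) (f : α → β → ℝ≥0∞) :
    (p.expect fun a => q.expect (f a)) = q.expect fun b => p.expect fun a => f a b := by
  simp only [expect, ← ENNReal.tsum_mul_left]
  rw [ENNReal.tsum_comm]
  simp only [mul_left_comm]

lemma bind_eq_of_forall_support (p : PMF α) {d : α → PMF β} {q : PMF β}
    (h : ∀ a ∈ p.support, d a = q) : p.bind d = q := by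
  ext b
  rw [bind_apply_eq_expect, p.expect_congr_support (g := fun _ => q b) (by
    intro a ha; rw [h a ha]), expect_const]

lemma expect_uniformOfFintype_equiv [Fintype α] [Nonempty α] (e : α ≃ α) (f : α → ℝ≥0∞) :
    (uniformOfFintype α).expect (fun a => f (e a)) = (uniformOfFintype α).expect f := by
  simp only [expect, uniformOfFintype_apply]
  exact e.tsum_eq fun a => ((Fintype.card α : ℝ≥0∞))⁻¹ * f a

lemma expect_uniformOfFinset (s : Finset α) (hs : s.Nonempty) (f : α → ℝ≥0∞) :
    (uniformOfFinset s hs).expect f = (s.card : ℝ≥0∞)⁻¹ * ∑ a ∈ s, f a := by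
  rw [expect, tsum_eq_sum (s := s), Finset.mul_sum]
  · exact Finset.sum_congr rfl fun a ha => by rw [uniformOfFinset_apply_of_mem hs ha]
  · intro a ha
    rw [uniformOfFinset_apply_of_notMem hs ha, zero_mul]

end PMF

/-! ## Simulators that translate the messages of the adversary -/

namespace Prog

variable {Q R Q' R' α β S T : Type}

/-- Sequential composition of programs. -/
def bind : Prog Q R α → (α → Prog Q R β) → Prog Q R β
  | .ret a, f => f a
  | .sample d next, f => .sample d fun b => (next b).bind f
  | .query q next, f => .query q fun r => (next r).bind f

/-- Answer the queries of a program with the help of a stateful translator. -/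
def translate (conv : T → Q → Prog Q' R' (R × T)) : Prog Q R α → T → Prog Q' R' (α × T)
  | .ret a, t => .ret (a, t)
  | .sample d next, t => .sample d fun b => (next b).translate conv t
  | .query q next, t => (conv t q).bind fun p => (next p.1).translate conv p.2

lemma run_bind (step : S → Q → PMF (R × S)) (p : Prog Q R α) (f : α → Prog Q R β) (s : S) :
    (p.bind f).run step s = (p.run step s).bind fun x => (f x.1).run step x.2 := by
  induction p generalizing s with
  | ret a => simp [bind, run]
  | sample d next ih => simp [bind, run, ih]
  | query q next ih => simp [bind, run, ih]

end Prog

section Simulation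

variable {EIn EOut AIn AOut AIn' AOut' ZIn ZOut T : Type}

/-- The simulator that runs the adversary `A` and answers its messages to the world through a
stateful translator. -/
def Adversary.translate (A : Adversary AIn AOut ZIn ZOut)
    (conv : T → AIn → Prog AIn' AOut' (AOut × T)) (t₀ : T) : Adversary AIn' AOut' ZIn ZOut where
  State := A.State × T
  init := A.init.map fun a => (a, t₀)
  act s q := ((A.act s.1 q).translate conv s.2).bind fun p => .ret (p.1.1, p.1.2, p.2)

/-- A simulation with error: `Rel t s μ δ` says that the translator in state `t` with the ideal
world in state `s` simulates the random state `μ` of the real world up to the error `δ`. -/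
structure ApproxSimulation (real : World EIn EOut AIn AOut) (ideal : World EIn EOut AIn' AOut')
    (conv : T → AIn → Prog AIn' AOut' (AOut × T))
    (Rel : T → ideal.State → PMF real.State → ℝ≥0∞ → Prop) : Prop where
  env : ∀ {t s μ δ}, Rel t s μ δ → ∀ q (g : EOut × real.State → ℝ≥0∞)
    (g' : EOut × T × ideal.State → ℝ≥0∞),
    (∀ x t' s' μ' δ', Rel t' s' μ' δ' → μ'.expect (fun w => g (x, w)) ≤ g' (x, t', s') + δ') →
    μ.expect (fun w => (real.env w q).expect g) ≤
      (ideal.env s q).expect (fun z => g' (z.1, t, z.2)) + δ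
  adv : ∀ {t s μ δ}, Rel t s μ δ → ∀ q (g : AOut × real.State → ℝ≥0∞)
    (g' : (AOut × T) × ideal.State → ℝ≥0∞), (∀ z, g' z ≤ 1) →
    (∀ x t' s' μ' δ', Rel t' s' μ' δ' → μ'.expect (fun w => g (x, w)) ≤ g' ((x, t'), s') + δ') →
    μ.expect (fun w => (real.adv w q).expect g) ≤ ((conv t q).run ideal.adv s).expect g' + δ

namespace ApproxSimulation

variable {real : World EIn EOut AIn AOut} {ideal : World EIn EOut AIn' AOut'}
  {conv : T → AIn → Prog AIn' AOut' (AOut × T)}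
  {Rel : T → ideal.State → PMF real.State → ℝ≥0∞ → Prop}

/-- Induction on the program, with `g` and `g'` standing for whatever happens after it ends. Errors
do not add up over the queries, because the relation after each query carries its own remaining
budget. -/
lemma run_le (H : ApproxSimulation real ideal conv Rel) {α : Type} (p : Prog AIn AOut α)
    {t : T} {s : ideal.State} {μ : PMF real.State} {δ : ℝ≥0∞} (h : Rel t s μ δ)
    (g : α × real.State → ℝ≥0∞) (g' : (α × T) × ideal.State → ℝ≥0∞) (hg' : ∀ z, g' z ≤ 1)
    (hgg' : ∀ x t' s' μ' δ', Rel t' s' μ' δ' →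
      μ'.expect (fun w => g (x, w)) ≤ g' ((x, t'), s') + δ') :
    μ.expect (fun w => (p.run real.adv w).expect g) ≤
      ((p.translate conv t).run ideal.adv s).expect g' + δ := by
  induction p generalizing t s μ δ with
  | ret a => simpa [Prog.run, Prog.translate] using hgg' a t s μ δ h
  | sample d next ih =>
    simp only [Prog.run, Prog.translate, PMF.expect_bind]
    rw [PMF.expect_comm]
    exact d.expect_le_expect_add fun b => ih b h
  | query q next ih =>
    simp only [Prog.run, Prog.translate, PMF.expect_bind, Prog.run_bind]
    -- The continuation of this query is the rest of the run; its bound by 1 is inherited from `g'`.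
    exact H.adv h q (fun x => ((next x.1).run real.adv x.2).expect g) _
      (fun z => PMF.expect_le_one _ hg') fun x t' s' μ' δ' h' => ih x h'

/-- The same induction one level up; `run_le` handles each activation of the adversary. The bound is
one-sided but holds for either output bit. -/
lemma runFrom_le (H : ApproxSimulation real ideal conv Rel) (A : Adversary AIn AOut ZIn ZOut)
    (t₀ : T) (Z : Environment EIn EOut ZIn ZOut) {t : T} {s : ideal.State} {μ : PMF real.State}
    {δ : ℝ≥0∞} (h : Rel t s μ δ) (a : A.State) (b : Bool) :
    μ.expect (fun w => Z.runFrom real A w a b) ≤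
      Z.runFrom ideal (A.translate conv t₀) s (a, t) b + δ := by
  induction Z generalizing t s μ δ a with
  | halt guess => simp [Environment.runFrom]
  | sample d next ih =>
    simp only [Environment.runFrom, PMF.bind_apply_eq_expect]
    rw [PMF.expect_comm]
    exact d.expect_le_expect_add fun b => ih b h a
  | callParties q next ih =>
    simp only [Environment.runFrom, PMF.bind_apply_eq_expect]
    exact H.env h q (fun p => (next p.1).runFrom real A p.2 a b)
      (fun p => (next p.1).runFrom ideal (A.translate conv t₀) p.2.2 (a, p.2.1) b)
      fun x t' s' μ' δ' h' => ih x h' a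
  | callAdversary q next ih =>
    simp only [Environment.runFrom, PMF.bind_apply_eq_expect]
    refine (H.run_le (A.act a q) h (fun p => (next p.1.1).runFrom real A p.2 p.1.2 b)
      (fun p => (next p.1.1.1).runFrom ideal (A.translate conv t₀) p.2 (p.1.1.2, p.1.2) b)
      (fun z => PMF.coe_le_one _ _) fun x t' s' μ' δ' h' => ih x.1 h' x.2).trans_eq ?_
    simp only [Adversary.translate, Prog.run_bind, PMF.expect_bind, Prog.run, PMF.expect_pure]

/-- A simulation with error from the initial states on yields universally composable
realization. -/
theorem ucRealizes (H : ApproxSimulation real ideal conv Rel) {t₀ : T} {ε : ℝ} (hε : 0 ≤ ε)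
    (h₀ : Rel t₀ ideal.init (PMF.pure real.init) (ENNReal.ofReal ε)) :
    UCRealizes real ideal ε := by
  intro ZIn ZOut A
  refine ⟨A.translate conv t₀, fun Z => ?_⟩
  have key : ∀ b, execution real A Z b ≤
      execution ideal (A.translate conv t₀) Z b + ENNReal.ofReal ε := by
    intro b
    have hexec : execution ideal (A.translate conv t₀) Z b =
        A.init.expect fun a => Z.runFrom ideal (A.translate conv t₀) ideal.init (a, t₀) b :=
      A.init.expect_map (fun a => (a, t₀))
        fun a => Z.runFrom ideal (A.translate conv t₀) ideal.init a b
    rw [hexec, execution, PMF.bind_apply_eq_expect]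
    refine A.init.expect_le_expect_add fun a => ?_
    simpa using H.runFrom_le A t₀ Z h₀ a b
  have toReal_le : ∀ b, (execution real A Z b).toReal ≤
      (execution ideal (A.translate conv t₀) Z b).toReal + ε := by
    intro b
    have := ENNReal.toReal_mono (by simp [PMF.apply_ne_top]) (key b)
    rwa [ENNReal.toReal_add (PMF.apply_ne_top _ _) ENNReal.ofReal_ne_top,
      ENNReal.toReal_ofReal hε] at this
  -- The two output probabilities sum to 1, so the upper bound for `false` is the missing lower
  -- bound for `true`.
  have total : ∀ p : PMF Bool, (p true).toReal + (p false).toReal = 1 := by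
    intro p
    rw [← ENNReal.toReal_add (p.apply_ne_top _) (p.apply_ne_top _), ← ENNReal.toReal_one,
      ← p.tsum_coe, tsum_fintype, Fintype.sum_bool]
  have h₁ := toReal_le true
  have h₂ := toReal_le false
  have h₃ := total (execution real A Z)
  have h₄ := total (execution ideal (A.translate conv t₀) Z)
  rw [abs_le]
  constructor <;> linarith

end ApproxSimulation

end Simulation

/-! ## Additive sharings -/

section Sharings

variable {n N : ℕ}

@[simp] lemma reconstruct_add (v w : Sharing n N) :
    reconstruct (v + w) = reconstruct v + reconstruct w := by
  simp [reconstruct, Finset.sum_add_distrib]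

@[simp] lemma reconstruct_sub (v w : Sharing n N) :
    reconstruct (v - w) = reconstruct v - reconstruct w := by
  simp [reconstruct, Finset.sum_sub_distrib]

@[simp] lemma reconstruct_single (h : Fin n) (a : ZMod N) :
    reconstruct (Pi.single h a : Sharing n N) = a := by
  simp [reconstruct]

/-- Correct the share of the party `h` such that the shared value becomes `a`. -/
def complete (h : Fin n) (v : Sharing n N) (a : ZMod N) : Sharing n N :=
  v + Pi.single h (a - reconstruct v)

@[simp] lemma reconstruct_complete (h : Fin n) (v : Sharing n N) (a : ZMod N) :
    reconstruct (complete h v a) = a := by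
  simp [complete]

lemma complete_apply_of_ne {h i : Fin n} (hi : i ≠ h) (v : Sharing n N) (a : ZMod N) :
    complete h v a i = v i := by
  simp [complete, hi]

/-- A sharing is determined by its value and by all shares except that of `h`. -/
lemma complete_eq_of_forall_ne {h : Fin n} {v w : Sharing n N} {a : ZMod N}
    (hvw : ∀ i, i ≠ h → w i = v i) (hw : reconstruct w = a) : complete h v a = w := by
  have hs : w = v + Pi.single h (w h - v h) := by
    ext i
    by_cases hi : i = h
    · subst hi; simp
    · simp [hi, hvw i hi]
  have ha : w h - v h = a - reconstruct v := by
    have := congrArg reconstruct hs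
    rw [reconstruct_add, reconstruct_single, hw] at this
    rw [this]; ring
  rw [complete, ← ha, ← hs]

lemma corruptPart_complete {C : Finset (Fin n)} {h : Fin n} (hh : h ∉ C) (v : Sharing n N)
    (a : ZMod N) : corruptPart C (complete h v a) = corruptPart C v := by
  ext i
  exact complete_apply_of_ne (ne_of_mem_of_not_mem i.2 hh) v a

section Random

variable [NeZero n] [NeZero N]

/-- The fibre over a sharing of `a` consists of the `N` vectors obtained by changing the share of
`h`, so the uniform law is mapped to the uniform law. This separates the shared value from the
shares of all parties other than `h`. -/
lemma share_eq_map_complete (h : Fin n) (a : ZMod N) :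
    share a = (PMF.uniformOfFintype (Sharing n N)).map fun v => complete h v a := by
  classical
  have hfib : ∀ w : Sharing n N, reconstruct w = a →
      (Finset.univ.filter fun v : Sharing n N => w = complete h v a).card = N := by
    intro w hw
    have : (Finset.univ.filter fun v : Sharing n N => w = complete h v a) =
        Finset.univ.image fun z : ZMod N => w + Pi.single h z := by
      ext v
      simp only [Finset.mem_filter, Finset.mem_univ, true_and, Finset.mem_image]
      constructor
      · intro hv
        -- The witness is the amount that completion subtracts from the share of `h`.
        exact ⟨reconstruct v - a, by rw [hv, complete, add_assoc, ← Pi.single_add]; simp⟩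
      · rintro ⟨z, rfl⟩
        refine (complete_eq_of_forall_ne (fun i hi => ?_) hw).symm
        simp [hi]
    rw [this, Finset.card_image_of_injective _ (fun z z' hz => by simpa using hz),
      Finset.card_univ, ZMod.card]
  have hcard : Fintype.card (Sharing n N) =
      (Finset.univ.filter fun v : Sharing n N => reconstruct v = a).card * N := by
    rw [← Finset.card_univ, Finset.card_eq_sum_card_fiberwise (f := fun v => complete h v a)
      (t := Finset.univ.filter fun v : Sharing n N => reconstruct v = a) (by intro v; simp)]
    rw [Finset.sum_congr rfl (g := fun _ => N) fun w hw => ?_, Finset.sum_const, smul_eq_mul]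
    refine Eq.trans ?_ (hfib w (by simpa using hw))
    simp only [eq_comm]
  ext w
  rw [PMF.map_apply, tsum_fintype]
  simp only [PMF.uniformOfFintype_apply]
  rw [← Finset.sum_filter, Finset.sum_const]
  by_cases hw : reconstruct w = a
  · rw [hfib w hw, share, PMF.uniformOfFinset_apply_of_mem _ (by simpa using hw), hcard]
    have hN : (N : ℝ≥0∞) ≠ 0 := by simp [NeZero.ne N]
    push_cast
    rw [ENNReal.mul_inv (Or.inr (by simp)) (Or.inr hN), nsmul_eq_mul, mul_comm, mul_assoc,
      ENNReal.inv_mul_cancel hN (by simp), mul_one]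
  · rw [share, PMF.uniformOfFinset_apply_of_notMem _ (by simpa using hw),
      Finset.filter_false_of_mem, Finset.card_empty, zero_smul]
    rintro v - rfl
    simp at hw

/-- Reflection in `A` permutes the vectors and commutes with completion; party `0` is an arbitrary
choice of the corrected one. -/
lemma map_sub_share (A : Sharing n N) (a : ZMod N) :
    (share a).map (fun u => A - u) = share (reconstruct A - a) := by
  have hmap : ∀ p : PMF (Sharing n N), p.map (fun u => A - u) =
      p.bind fun u => PMF.pure (A - u) := fun p => rfl
  ext w
  rw [hmap, PMF.bind_apply_eq_expect, share_eq_map_complete 0, share_eq_map_complete 0,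
    PMF.expect_map, PMF.map, PMF.bind_apply_eq_expect]
  refine Eq.trans ?_ (PMF.expect_uniformOfFintype_equiv (Equiv.subLeft A) _)
  congr 1
  ext v
  have : complete 0 (A - v) (reconstruct A - a) = A - complete 0 v a :=
    complete_eq_of_forall_ne (fun i hi => by simp [complete_apply_of_ne hi]) (by simp)
  simp [this]

lemma reconstruct_of_mem_support_share {a : ZMod N} {v : Sharing n N}
    (hv : v ∈ (share a).support) : reconstruct v = a := by
  simpa [share] using hv

end Random

section Authentication

variable {C : Finset (Fin n)}

lemma reconstruct_contributed (v : Sharing n N) (e : CorruptShares N C) :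
    reconstruct (contributed v e) = reconstruct v - ∑ i, corruptPart C v i + ∑ i, e i := by
  classical
  have split : ∀ w : Sharing n N, reconstruct w =
      ∑ i : {i // i ∈ C}, w i + ∑ i : {i // i ∉ C}, w i := fun w => by
    rw [reconstruct, ← Fintype.sum_subtype_add_sum_subtype (fun i => i ∈ C) w]
    congr!
  rw [split (contributed v e), split v]
  have h₁ : ∀ i : {i // i ∈ C}, contributed v e i = e i := fun i => by simp [contributed, i.2]
  have h₂ : ∀ i : {i // i ∉ C}, contributed v e i = v i := fun i => by simp [contributed, i.2]
  simp only [h₁, h₂, corruptPart]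
  ring

/-- The honest shares cancel, so a simulator that knows only corrupted shares can decide whether the
honest parties abort. -/
lemma authentic_iff (v : Sharing n N) (e : CorruptShares N C) :
    authentic v e ↔ ∑ i, e i = ∑ i, corruptPart C v i := by
  rw [authentic, reconstruct_contributed]
  constructor
  · intro h; linear_combination h
  · intro h; linear_combination h

lemma authentic_congr {v w : Sharing n N} (h : corruptPart C v = corruptPart C w)
    (e : CorruptShares N C) : authentic v e ↔ authentic w e := by
  rw [authentic_iff, authentic_iff, h]

lemma contributed_corruptPart (v : Sharing n N) : contributed v (corruptPart C v) = v := by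
  ext i
  simp [contributed, corruptPart]

lemma authentic_corruptPart (v : Sharing n N) : authentic v (corruptPart C v) := by
  rw [authentic, contributed_corruptPart]

end Authentication

end Sharings

/-! ## Independent calls -/

section Parallel

variable {α β γ : Type}

/-- By independence, the first stages of all calls may be drawn before all second stages. Here the
first stage is the vector seen in part by the adversary, the second the hidden bit. -/
lemma expect_parallel_bind (d : PMF α) (e : PMF β) (G : α → β → γ) (k : ℕ)
    (F : (Fin k → γ) → ℝ≥0∞) :
    (parallel (d.bind fun a => e.map (G a)) k).expect F =
      (parallel d k).expect fun v => (parallel e k).expect fun b => F fun j => G (v j) (b j) := by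
  induction k with
  | zero =>
    simp only [parallel, PMF.expect_pure]
    congr 1
    exact Subsingleton.elim _ _
  | succ k ih =>
    simp only [parallel, PMF.expect_bind, PMF.expect_pure, PMF.expect_map, ih]
    congr 1
    ext a
    rw [PMF.expect_comm]
    congr 1
    ext v
    congr 1
    ext b
    congr 1
    ext f
    congr 1
    ext j
    refine Fin.cases ?_ (fun j => ?_) j <;> simp

lemma mem_support_of_mem_support_parallel (d : PMF α) (k : ℕ) {f : Fin k → α}
    (hf : f ∈ (parallel d k).support) (j : Fin k) : f j ∈ d.support := by
  induction k with
  | zero => exact j.elim0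
  | succ k ih =>
    simp only [parallel, PMF.mem_support_bind_iff, PMF.support_pure, Set.mem_singleton_iff] at hf
    obtain ⟨a, ha, v, hv, rfl⟩ := hf
    refine Fin.cases ?_ (fun j => ?_) j
    · simpa using ha
    · simpa using ih hv j

/-- The integer with the given bits. -/
def bitSum {m k : ℕ} (hm : m ≤ k) (b : Fin k → Bool) : ℕ :=
  ∑ j : Fin m, 2 ^ (j : ℕ) * (b (Fin.castLE hm j)).toNat

/-- Horner's rule, splitting off the lowest bit, which is the one that `parallel` draws first. -/
lemma bitSum_succ {m k : ℕ} (hm : m ≤ k) (b : Bool) (f : Fin k → Bool) :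
    bitSum (Nat.succ_le_succ hm) (Fin.cons b f : Fin (k + 1) → Bool) =
      b.toNat + 2 * bitSum hm f := by
  simp only [bitSum]
  rw [Fin.sum_univ_succ, Finset.mul_sum]
  congr 1
  · simp
  · refine Finset.sum_congr rfl fun j _ => ?_
    have : Fin.castLE (Nat.succ_le_succ hm) j.succ = (Fin.castLE hm j).succ := rfl
    rw [this, Fin.cons_succ, Fin.val_succ]
    ring

lemma bitSum_lt {m k : ℕ} (hm : m ≤ k) (b : Fin k → Bool) : bitSum hm b < 2 ^ m := by
  induction m generalizing k with
  | zero => simp [bitSum]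
  | succ m ih =>
    obtain ⟨k, rfl⟩ : ∃ l, k = l + 1 := ⟨k - 1, by omega⟩
    have h := ih (Nat.le_of_succ_le_succ hm) (Fin.tail b)
    rw [← Fin.cons_self_tail b, bitSum_succ (Nat.le_of_succ_le_succ hm)]
    have := (b 0).toNat_le
    rw [pow_succ]
    omega

/-- Division with remainder by `b`: the outer index is the quotient, the inner one the remainder. -/
lemma sum_range_mul_add (a b : ℕ) (F : ℕ → ℝ≥0∞) :
    ∑ i ∈ Finset.range (a * b), F i =
      ∑ i ∈ Finset.range a, ∑ j ∈ Finset.range b, F (j + b * i) := by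
  induction a with
  | zero => simp
  | succ a ih =>
    rw [Finset.sum_range_succ, Nat.succ_mul, Finset.sum_range_add, ih]
    congr 1
    exact Finset.sum_congr rfl fun j _ => by rw [mul_comm, add_comm]

/-- The integer that consists of some of several independent uniform bits is uniform. -/
lemma expect_bitSum {m k : ℕ} (hm : m ≤ k) (F : ℕ → ℝ≥0∞) :
    (parallel (PMF.uniformOfFintype Bool) k).expect (fun b => F (bitSum hm b)) =
      (2 ^ m : ℝ≥0∞)⁻¹ * ∑ i ∈ Finset.range (2 ^ m), F i := by
  induction m generalizing k F with
  | zero => simp [bitSum]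
  | succ m ih =>
    obtain ⟨k, rfl⟩ : ∃ l, k = l + 1 := ⟨k - 1, by omega⟩
    simp only [parallel, PMF.expect_bind, PMF.expect_pure,
      bitSum_succ (Nat.le_of_succ_le_succ hm)]
    have step : ∀ a : Bool, ((parallel (PMF.uniformOfFintype Bool) k).expect fun b =>
        F (a.toNat + 2 * bitSum (Nat.le_of_succ_le_succ hm) b)) = _ :=
      fun a => ih _ fun i => F (a.toNat + 2 * i)
    simp only [step]
    rw [pow_succ (2 : ℕ) m, sum_range_mul_add, pow_succ (2 : ℝ≥0∞),
      ENNReal.mul_inv (by simp) (by simp)]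
    simp only [PMF.expect, PMF.uniformOfFintype_apply, tsum_fintype, Fintype.sum_bool,
      Fintype.card_bool, Finset.sum_range_succ, Finset.sum_range_zero, Finset.sum_add_distrib]
    simp only [Bool.toNat_true, Bool.toNat_false, zero_add, Nat.cast_ofNat,
      Finset.sum_const_zero]
    ring

/-- The masked integer is uniform. -/
lemma expect_bitSum_add_uniform {m k l : ℕ} (hm : m ≤ k)
    (hl : (Finset.range (2 ^ l)).Nonempty) (F : ℕ → ℝ≥0∞) :
    ((parallel (PMF.uniformOfFintype Bool) k).expect fun b =>
      (PMF.uniformOfFinset (Finset.range (2 ^ l)) hl).expect fun ρ =>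
        F (bitSum hm b + 2 ^ m * ρ)) =
      (2 ^ (m + l) : ℝ≥0∞)⁻¹ * ∑ i ∈ Finset.range (2 ^ (m + l)), F i := by
  rw [PMF.expect_comm]
  have step : ∀ ρ, ((parallel (PMF.uniformOfFintype Bool) k).expect fun b =>
      F (bitSum hm b + 2 ^ m * ρ)) = _ := fun ρ => expect_bitSum hm fun i => F (i + 2 ^ m * ρ)
  simp only [step]
  rw [PMF.expect_uniformOfFinset, ← Finset.mul_sum, ← mul_assoc, add_comm m l, pow_add, pow_add,
    sum_range_mul_add, ENNReal.mul_inv (by simp) (by simp)]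
  simp

/-- A bounded function of a shifted uniform integer has almost the same expectation. -/
lemma sum_range_shift_le (M y : ℕ) (F : ℕ → ℝ≥0∞) (hF : ∀ i, F i ≤ 1) :
    ∑ i ∈ Finset.range M, F (i + y) ≤ ∑ i ∈ Finset.range M, F i + y := by
  -- Adding the terms below `y` gives the sum over `[0, M + y)`; it is cut again at `M`, and the
  -- last `y` terms are at most 1 each.
  calc ∑ i ∈ Finset.range M, F (i + y)
      ≤ ∑ i ∈ Finset.range y, F i + ∑ i ∈ Finset.range M, F (y + i) := by
        simp only [add_comm y]; exact le_add_self
    _ = ∑ i ∈ Finset.range M, F i + ∑ i ∈ Finset.range y, F (M + i) := by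
        rw [← Finset.sum_range_add, ← Finset.sum_range_add, add_comm]
    _ ≤ ∑ i ∈ Finset.range M, F i + y := by
        gcongr
        exact (Finset.sum_le_sum fun i _ => hF _).trans (by simp)

end Parallel

/-! ## The values that are computed by the protocol -/

section Values

variable {n N k κ : ℕ}

lemma sum_lowShare (r : Fin k → Sharing n N) :
    ∑ i, lowShare (fun j => r j i) = lowShare fun j => reconstruct (r j) := by
  simp only [lowShare, lowBits, reconstruct, Finset.mul_sum]
  exact Finset.sum_comm

/-- The input, shifted into the range `0, …, 2 ^ k - 1`. -/
def shiftedInput (x : SignedSharing n N k) : ℕ :=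
  ((2 : ℤ) ^ (k - 1) + (reconstruct x.1).valMinAbs).toNat

lemma coe_shiftedInput (x : SignedSharing n N k) :
    (shiftedInput x : ℤ) = 2 ^ (k - 1) + (reconstruct x.1).valMinAbs :=
  Int.toNat_of_nonneg (by linarith [x.2.1])

lemma cast_shiftedInput (x : SignedSharing n N k) :
    (shiftedInput x : ZMod N) = 2 ^ (k - 1) + reconstruct x.1 := by
  have := congrArg (Int.cast : ℤ → ZMod N) (coe_shiftedInput x)
  push_cast at this
  simpa using this

lemma shiftedInput_lt (hk : 1 ≤ k) (x : SignedSharing n N k) : shiftedInput x < 2 ^ k := by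
  have h₁ := x.2.2
  have h₂ := coe_shiftedInput x
  have h₃ : (2 : ℤ) ^ k = 2 * 2 ^ (k - 1) := by
    rw [← pow_succ', Nat.sub_add_cancel hk]
  zify
  omega

lemma lowShare_bits (b : Fin k → Bool) :
    lowShare (fun j => if b j then (1 : ZMod N) else 0) = bitSum (Nat.sub_le k 1) b := by
  simp only [lowShare, lowBits, bitSum]
  push_cast
  refine Finset.sum_congr rfl fun j _ => ?_
  cases b (Fin.castLE (Nat.sub_le k 1) j) <;> simp

lemma sum_val_lowBits (hN : 1 < N) {r : Fin k → Sharing n N} {b : Fin k → Bool}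
    (hr : ∀ j, reconstruct (r j) = if b j then 1 else 0) :
    ∑ j : Fin (k - 1), 2 ^ (j : ℕ) * (reconstruct (lowBits r j)).val =
      bitSum (Nat.sub_le k 1) b := by
  have : Fact (1 < N) := ⟨hN⟩
  refine Finset.sum_congr rfl fun j _ => ?_
  rw [lowBits, hr]
  cases b (Fin.castLE (Nat.sub_le k 1) j) <;> simp [ZMod.val_one]

variable [NeZero n]

lemma reconstruct_constShare (a : ZMod N) : ∑ i : Fin n, constShare a i = a := by
  simp [constShare]

lemma reconstruct_maskSharing (x : Sharing n N) (r : Fin k → Sharing n N) (r'' : Sharing n N) :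
    reconstruct (maskSharing x r r'') =
      2 ^ (k - 1) * reconstruct r'' + lowShare (fun j => reconstruct (r j)) + 2 ^ (k - 1) +
        reconstruct x := by
  rw [← sum_lowShare]
  conv_lhs => rw [reconstruct]
  simp only [maskSharing, maskShare, Finset.sum_add_distrib, reconstruct_constShare,
    ← Finset.mul_sum]
  rfl

lemma reconstruct_outSharing_zero (x : Sharing n N) (r : Fin k → Sharing n N) (c : ZMod N) :
    reconstruct (outSharing x r c 0) =
      1 + (reconstruct x - (lowPart k c - lowShare fun j => reconstruct (r j))) *
        ((2 : ZMod N) ^ (k - 1))⁻¹ := by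
  rw [← sum_lowShare]
  conv_lhs => rw [reconstruct]
  simp only [outSharing, outShare, Finset.sum_add_distrib, reconstruct_constShare,
    ← Finset.sum_mul, Finset.sum_sub_distrib, Pi.zero_apply, mul_zero, add_zero]
  rfl

lemma two_pow_mul_inv (hN : Odd N) (m : ℕ) : (2 : ZMod N) ^ m * (2 ^ m)⁻¹ = 1 := by
  have := ZMod.coe_mul_inv_eq_one (n := N) (2 ^ m) (Nat.Coprime.pow_left m
    (Nat.coprime_two_left.2 hN))
  exact_mod_cast this

/-- The factor `2 ^ (k - 1)` of `u` cancels against its inverse, so the comparison share enters with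
coefficient -1 and rerandomizes the output. -/
lemma outShare_eq_sub (hN : Odd N) (i : Fin n) (x : ZMod N) (r : Fin k → ZMod N) (c u : ZMod N) :
    outShare i x r c u = outShare i x r c 0 - u := by
  simp only [outShare]
  linear_combination -u * two_pow_mul_inv hN (k - 1)

lemma outSharing_eq_sub (hN : Odd N) (x : Sharing n N) (r : Fin k → Sharing n N) (c : ZMod N)
    (u : Sharing n N) : outSharing x r c u = outSharing x r c 0 - u := by
  ext i
  exact outShare_eq_sub hN i _ _ c _

lemma reconstruct_maskSharing_of_bits (x : SignedSharing n N k) {r : Fin k → Sharing n N}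
    {r'' : Sharing n N} {b : Fin k → Bool} {ρ : ℕ}
    (hr : ∀ j, reconstruct (r j) = if b j then 1 else 0) (hr'' : reconstruct r'' = ρ) :
    reconstruct (maskSharing x.1 r r'') =
      ((bitSum (Nat.sub_le k 1) b + 2 ^ (k - 1) * ρ + shiftedInput x : ℕ) : ZMod N) := by
  rw [reconstruct_maskSharing]
  simp only [hr, lowShare_bits, hr'']
  push_cast
  rw [cast_shiftedInput]
  ring

/-- The bit that the comparison functionality computes for the opened value `c`. -/
def comparisonBit (r : Fin k → Sharing n N) (c : ZMod N) : ZMod N :=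
  if lowPart k c < ∑ j : Fin (k - 1), 2 ^ (j : ℕ) * (reconstruct (lowBits r j)).val then 1 else 0

/-- The bit that the comparison with zero returns. -/
def signBit (x : Sharing n N) : ZMod N := if 0 ≤ (reconstruct x).valMinAbs then 1 else 0

/-- If the masked value is computed from shared bits, then the output is the sign. -/
lemma outSharing_sub_comparisonBit (hN : Odd N) (hk : 1 ≤ k)
    (hsize : 2 ^ (k + κ) + 2 ^ k ≤ N + 1) (x : SignedSharing n N k) {r : Fin k → Sharing n N}
    {b : Fin k → Bool} {ρ : ℕ} (hr : ∀ j, reconstruct (r j) = if b j then 1 else 0)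
    (hρ : ρ < 2 ^ (κ + 1)) {c : ZMod N}
    (hc : c = ((bitSum (Nat.sub_le k 1) b + 2 ^ (k - 1) * ρ + shiftedInput x : ℕ) : ZMod N)) :
    reconstruct (outSharing x.1 r c 0) - comparisonBit r c = signBit x.1 := by
  have hR := bitSum_lt (Nat.sub_le k 1) b
  have hy := shiftedInput_lt hk x
  have hyX : (shiftedInput x : ℤ) = (2 ^ (k - 1) : ℕ) + (reconstruct x.1).valMinAbs := by
    push_cast; exact coe_shiftedInput x
  have hinv := two_pow_mul_inv hN (k - 1)
  have hN1 : 1 < N := by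
    have h₁ : 2 ^ 1 ≤ 2 ^ k := Nat.pow_le_pow_right two_pos hk
    have h₂ : 2 ^ k ≤ 2 ^ (k + κ) := Nat.pow_le_pow_right two_pos (Nat.le_add_right k κ)
    omega
  -- No wrap-around: the sum is at most (2^(k+κ) - 1) + (2^k - 1), which `hsize` bounds by N - 1.
  have hval : c.val = bitSum (Nat.sub_le k 1) b + 2 ^ (k - 1) * ρ + shiftedInput x := by
    rw [hc, ZMod.val_natCast_of_lt]
    have h₁ : 2 ^ (k - 1) * (ρ + 1) ≤ 2 ^ (k - 1) * 2 ^ (κ + 1) :=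
      Nat.mul_le_mul_left _ hρ
    rw [← pow_add, show k - 1 + (κ + 1) = k + κ by omega, Nat.mul_add] at h₁
    omega
  have hx : (reconstruct x.1 : ZMod N) = shiftedInput x - 2 ^ (k - 1) := by
    rw [cast_shiftedInput]; ring
  rw [reconstruct_outSharing_zero, comparisonBit, signBit, sum_val_lowBits hN1 hr, lowPart, hval]
  simp only [hr, lowShare_bits]
  generalize (reconstruct x.1).valMinAbs = X at hyX ⊢
  rw [hx]
  have hP : 2 ^ k = 2 * 2 ^ (k - 1) := by rw [← pow_succ', Nat.sub_add_cancel hk]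
  have hPpos : 0 < 2 ^ (k - 1) := by positivity
  have hPcast : ((2 ^ (k - 1) : ℕ) : ZMod N) = 2 ^ (k - 1) := by push_cast; rfl
  rw [← hPcast] at hinv ⊢
  rw [hP] at hy
  generalize 2 ^ (k - 1) = P at *
  generalize bitSum (Nat.sub_le k 1) b = R at *
  generalize shiftedInput x = y at *
  -- `q` is the top bit of the shifted input, hence the sign bit, and `z` is its low part, the value
  -- that x' should have.
  obtain ⟨q, z, hq, hz, rfl⟩ : ∃ q z, q < 2 ∧ z < P ∧ y = P * q + z :=
    ⟨y / P, y % P, by rw [Nat.div_lt_iff_lt_mul hPpos]; omega, Nat.mod_lt _ hPpos,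
      (Nat.div_add_mod _ _).symm⟩
  have hmod : (R + P * ρ + (P * q + z)) % P = (R + z) % P := by
    rw [show R + P * ρ + (P * q + z) = R + z + P * (ρ + q) by ring, Nat.add_mul_mod_self_left]
  have hsign : (if 0 ≤ X then (1 : ZMod N) else 0) = q := by
    interval_cases q
    · rw [if_neg (by push_cast at hyX; omega)]; simp
    · rw [if_pos (by push_cast at hyX; omega)]; simp
  rw [hmod, hsign]
  -- The carry of `R + z`. Without it c' = R + z ≥ R; with it c' = R + z - P < R. So comparing c'
  -- with `R` detects the carry.
  by_cases hlt : R + z < P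
  · rw [Nat.mod_eq_of_lt hlt, if_neg (by omega)]
    push_cast
    linear_combination (q - 1 : ZMod N) * hinv
  · have : (R + z) % P = R + z - P := by
      rw [Nat.mod_eq_sub_mod (by omega), Nat.mod_eq_of_lt (by omega)]
    rw [this, if_pos (by omega), Nat.cast_sub (by omega)]
    push_cast
    linear_combination (q : ZMod N) * hinv

variable [NeZero N]

/-- The output shares are a fresh sharing. -/
lemma map_outSharing_share (hN : Odd N) (x : Sharing n N) (r : Fin k → Sharing n N) (c a : ZMod N) :
    (share a).map (outSharing x r c) = share (reconstruct (outSharing x r c 0) - a) := by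
  rw [← map_sub_share]
  congr 1
  ext1 u
  exact outSharing_eq_sub hN x r c u

lemma exists_of_mem_support_fRndBit {v : Sharing n N} (hv : v ∈ (fRndBit).support) :
    ∃ b : Bool, reconstruct v = if b then 1 else 0 := by
  obtain ⟨b, -, hb⟩ := (PMF.mem_support_bind_iff _ _ _).1 hv
  exact ⟨b, reconstruct_of_mem_support_share hb⟩

lemma exists_of_mem_support_fPRndInt {l : ℕ} {v : Sharing n N}
    (hv : v ∈ (fPRndInt l).support) : ∃ ρ : ℕ, ρ < 2 ^ l ∧ reconstruct v = ρ := by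
  obtain ⟨ρ, hρ, hv⟩ := (PMF.mem_support_bind_iff _ _ _).1 hv
  exact ⟨ρ, by simpa using (PMF.mem_support_uniformOfFinset_iff _ _).1 hρ,
    reconstruct_of_mem_support_share hv⟩

/-- Correctness of the comparison protocol. -/
theorem gezProtocol_eq_fGEZ (hN : Odd N) (hk : 1 ≤ k) (hsize : 2 ^ (k + κ) + 2 ^ k ≤ N + 1)
    (x : SignedSharing n N k) : gezProtocol κ k x.1 = fGEZ x.1 := by
  -- The law of the output is already right conditionally on every possible pair of masks.
  refine PMF.bind_eq_of_forall_support _ fun r hr => ?_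
  refine PMF.bind_eq_of_forall_support _ fun r'' hr'' => ?_
  choose b hb using fun j =>
    exists_of_mem_support_fRndBit (mem_support_of_mem_support_parallel _ k hr j)
  obtain ⟨ρ, hρ, hr''⟩ := exists_of_mem_support_fPRndInt hr''
  have h := outSharing_sub_comparisonBit hN hk hsize x hb hρ
    (reconstruct_maskSharing_of_bits x hb hr'')
  have hmap := map_outSharing_share hN x.1 r (reconstruct (maskSharing x.1 r r''))
    (comparisonBit r (reconstruct (maskSharing x.1 r r'')))
  rw [h] at hmap
  exact hmap

end Values

/-! ## The simulator -/

section Security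

variable {n N k κ : ℕ}

/-- The states of the translator of the messages to the protocol. -/
inductive TranslatorState (n N k : ℕ) : Type
  | start
  | bits (x : Sharing n N) (v : Fin k → Sharing n N)
  | masked (x : Sharing n N) (v : Fin k → Sharing n N) (m : Sharing n N)
  | opening (x : Sharing n N) (v : Fin k → Sharing n N) (m : Sharing n N)
  | opened (x : Sharing n N) (v : Fin k → Sharing n N) (c : ZMod N)
  | compared
  | finished
  | aborted

variable [NeZero n]

/-- The mask is computed share by share: off `h` it depends on `v` and `w` alone, while `b` and `ρ`
enter only through the value. -/
lemma maskSharing_complete (h : Fin n) (x : SignedSharing n N k) (v : Fin k → Sharing n N)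
    (w : Sharing n N) (b : Fin k → Bool) (ρ : ℕ) :
    maskSharing x.1 (fun j => complete h (v j) (if b j then 1 else 0)) (complete h w ρ) =
      complete h (maskSharing x.1 v w)
        ((bitSum (Nat.sub_le k 1) b + 2 ^ (k - 1) * ρ + shiftedInput x : ℕ) : ZMod N) := by
  refine (complete_eq_of_forall_ne (fun i hi => ?_) ?_).symm
  · simp only [maskSharing, complete_apply_of_ne hi]
  · exact reconstruct_maskSharing_of_bits x (fun j => by simp) (by simp)

variable [NeZero N]

open Classical in
/-- The translator runs the protocol for the honest parties with the input shares `0` and with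
uniform shares of the random values; the masked value is a uniform integer, to which the
published share of the honest party `h` is adapted. -/
def gezTranslator (κ k : ℕ) (C : Finset (Fin n)) (h : Fin n) :
    TranslatorState n N k → HybridMsg N k C →
      Prog (IdealMsg N C) (IdealReply N C) (HybridReply N k C × TranslatorState n N k)
  | .start, .readInput => .query .readInput fun
      | .shares v => .ret (.shares v, .start)
      | _ => .ret (.refused, .start)
  | .start, .callRndBit => .query .readInput fun
      | .shares e => .sample (parallel (PMF.uniformOfFintype (Sharing n N)) k) fun v =>
          .ret (.bitShares (fun j => corruptPart C (v j)), .bits (contributed 0 e) v)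
      | _ => .ret (.refused, .start)
  | .bits x v, .callPRndInt =>
      .sample (PMF.uniformOfFintype (Sharing n N)) fun w =>
      .sample (PMF.uniformOfFinset (Finset.range (2 ^ (k + κ))) ⟨0, by simp⟩) fun c =>
        -- The whole masked sharing is fixed here, before it is published, so that the statistical
        -- error is spent in this step.
        .ret (.shares (corruptPart C w), .masked x v (complete h (maskSharing x v w) (c : ZMod N)))
  | .masked x v m, .openMask => .ret (.published (honestPart C m), .opening x v m)
  | .opening x v m, .publish e =>
      if authentic m e then .ret (.ack, .opened x v (reconstruct m))
      else .query .abort fun _ => .ret (.aborted, .aborted)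
  | .opened x v c, .callBitLTC e =>
      if ∀ j, authentic (lowBits v j) (e j) then
        .query (.submit (corruptPart C x)) fun
          -- Since s = A - u, the corrupted shares of the comparison bit are those of A - s.
          | .shares s => .ret (.shares (fun i => outSharing x v c 0 i - s i), .compared)
          | _ => .ret (.refused, .compared)
      else .query .abort fun _ => .ret (.aborted, .aborted)
  | .compared, .deliver => .query .deliver fun _ => .ret (.ack, .finished)
  | .start, .abort => .query .abort fun
      | .aborted => .ret (.aborted, .aborted)
      | _ => .ret (.refused, .start)
  | .finished, .abort => .ret (.refused, .finished)
  -- Answered locally: the protocol confirms a repeated abort, while the ideal world refuses it.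
  | .aborted, .abort => .ret (.aborted, .aborted)
  | _, .abort => .query .abort fun _ => .ret (.aborted, .aborted)
  | t, _ => .ret (.refused, t)

/-- The relation between the translator, the ideal world and the protocol, with the statistical
error that is still to come. -/
inductive GEZSimulates (ε : ℝ≥0∞) (C : Finset (Fin n)) (h : Fin n) :
    TranslatorState n N k → IdealState n N k → PMF (HybridState n N k) → ℝ≥0∞ → Prop
  | idle : GEZSimulates ε C h .start .idle (PMF.pure .idle) ε
  | ready (x : SignedSharing n N k) :
      GEZSimulates ε C h .start (.ready x) (PMF.pure (.ready x)) ε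
  | bits (x : SignedSharing n N k) (x' : Sharing n N) (v : Fin k → Sharing n N)
      (hx : corruptPart C x' = corruptPart C x.1) :
      -- The values of the bits are still random in the real state, since the adversary has seen
      -- only shares independent of them.
      GEZSimulates ε C h (.bits x' v) (.ready x)
        ((parallel (PMF.uniformOfFintype Bool) k).map fun b =>
          .bits x fun j => complete h (v j) (if b j then 1 else 0)) ε
  -- From here on the real state is a single point and the remaining error is 0: the translator
  -- holds the true masked sharing, and `hs` says that the output will be the sign.
  | masked (x : SignedSharing n N k) (x' : Sharing n N) (v r : Fin k → Sharing n N)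
      (r'' : Sharing n N) (hx : corruptPart C x' = corruptPart C x.1)
      (hv : ∀ j, corruptPart C (v j) = corruptPart C (r j))
      (hs : reconstruct (outSharing x.1 r (reconstruct (maskSharing x.1 r r'')) 0) -
        comparisonBit r (reconstruct (maskSharing x.1 r r'')) = signBit x.1) :
      GEZSimulates ε C h (.masked x' v (maskSharing x.1 r r'')) (.ready x)
        (PMF.pure (.masked x r r'')) 0
  | opening (x : SignedSharing n N k) (x' : Sharing n N) (v r : Fin k → Sharing n N)
      (r'' : Sharing n N) (hx : corruptPart C x' = corruptPart C x.1)
      (hv : ∀ j, corruptPart C (v j) = corruptPart C (r j))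
      (hs : reconstruct (outSharing x.1 r (reconstruct (maskSharing x.1 r r'')) 0) -
        comparisonBit r (reconstruct (maskSharing x.1 r r'')) = signBit x.1) :
      GEZSimulates ε C h (.opening x' v (maskSharing x.1 r r'')) (.ready x)
        (PMF.pure (.opening x r r'')) 0
  | opened (x : SignedSharing n N k) (x' : Sharing n N) (v r : Fin k → Sharing n N)
      (c : ZMod N) (hx : corruptPart C x' = corruptPart C x.1)
      (hv : ∀ j, corruptPart C (v j) = corruptPart C (r j))
      (hs : reconstruct (outSharing x.1 r c 0) - comparisonBit r c = signBit x.1) :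
      GEZSimulates ε C h (.opened x' v c) (.ready x) (PMF.pure (.opened x r c)) 0
  | compared (x : SignedSharing n N k) (r : Fin k → Sharing n N) (c : ZMod N)
      (u : Sharing n N) :
      GEZSimulates ε C h .compared (.computed (outSharing x.1 r c u))
        (PMF.pure (.compared x r c u)) 0
  | finished (s : Sharing n N) :
      GEZSimulates ε C h .finished (.finished s) (PMF.pure (.finished s)) 0
  | aborted : GEZSimulates ε C h .aborted .aborted (PMF.pure .aborted) 0

/-- The bit and the vector are independent, so the vector may be drawn first. -/
lemma fRndBit_eq_bind_complete (h : Fin n) :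
    (fRndBit : PMF (Sharing n N)) = (PMF.uniformOfFintype (Sharing n N)).bind fun v =>
      (PMF.uniformOfFintype Bool).map fun b => complete h v (if b then 1 else 0) := by
  simp only [fRndBit, share_eq_map_complete h, PMF.map]
  exact PMF.bind_comm _ _ _

lemma expect_fPRndInt (h : Fin n) (l : ℕ) (hl : (Finset.range (2 ^ l)).Nonempty)
    (F : Sharing n N → ℝ≥0∞) :
    (fPRndInt l).expect F = (PMF.uniformOfFintype (Sharing n N)).expect fun w =>
      (PMF.uniformOfFinset (Finset.range (2 ^ l)) hl).expect fun ρ => F (complete h w ρ) := by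
  rw [PMF.expect_comm]
  simp only [fPRndInt, PMF.expect_bind, share_eq_map_complete h, PMF.expect_map]

/-- The random integer hides the honest shares of the input in the shares of the masked value. -/
lemma expect_maskSharing_congr (hN : Odd N) {C : Finset (Fin n)} {x x' : Sharing n N}
    (hx : corruptPart C x' = corruptPart C x) (v : Fin k → Sharing n N)
    (G : CorruptShares N C → Sharing n N → ℝ≥0∞) :
    ((PMF.uniformOfFintype (Sharing n N)).expect fun w =>
        G (corruptPart C w) (maskSharing x v w)) =
      (PMF.uniformOfFintype (Sharing n N)).expect fun w =>
        G (corruptPart C w) (maskSharing x' v w) := by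
  -- Translating `w` by (x - x') / 2^(k-1) turns one mask into the other; the translation vanishes
  -- on `C`, where the two inputs agree.
  refine Eq.trans ?_ (PMF.expect_uniformOfFintype_equiv
    (Equiv.addRight fun i => ((2 : ZMod N) ^ (k - 1))⁻¹ * (x i - x' i)) _)
  congr 1
  ext w
  congr 1
  · ext i
    have : x' i = x i := congrFun hx i
    simp [corruptPart, this]
  · ext i
    simp only [maskSharing, maskShare, Equiv.coe_addRight, Pi.add_apply]
    linear_combination -(x i - x' i) * two_pow_mul_inv hN (k - 1)

/-- The shares of the random integer and of the masked value are statistically close to the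
simulated ones. -/
lemma expect_mask_le (hN : Odd N) (hk : 1 ≤ k) {C : Finset (Fin n)} {h : Fin n} (hh : h ∉ C)
    (x : SignedSharing n N k) {x' : Sharing n N} (hx : corruptPart C x' = corruptPart C x.1)
    (v : Fin k → Sharing n N) (hκ : (Finset.range (2 ^ (k + κ))).Nonempty)
    (G : CorruptShares N C → Sharing n N → ℝ≥0∞) (hG : ∀ e m, G e m ≤ 1) :
    ((parallel (PMF.uniformOfFintype Bool) k).expect fun b =>
      (fPRndInt (κ + 1)).expect fun r'' => G (corruptPart C r'')
        (maskSharing x.1 (fun j => complete h (v j) (if b j then 1 else 0)) r'')) ≤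
    ((PMF.uniformOfFintype (Sharing n N)).expect fun w =>
      (PMF.uniformOfFinset (Finset.range (2 ^ (k + κ))) hκ).expect fun c =>
        G (corruptPart C w) (complete h (maskSharing x' v w) (c : ZMod N))) +
      ENNReal.ofReal (2⁻¹ ^ κ) := by
  have hexp : k - 1 + (κ + 1) = k + κ := by omega
  have hl : (Finset.range (2 ^ (κ + 1))).Nonempty := ⟨0, by simp⟩
  simp only [expect_fPRndInt h (κ + 1) hl, corruptPart_complete hh, maskSharing_complete]
  -- The input is exchanged on the simulated side while `w` is still averaged; afterwards `w` can be
  -- fixed and only the shift of the opened integer remains.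
  rw [PMF.expect_comm, ← expect_maskSharing_congr hN hx v fun e m =>
    (PMF.uniformOfFinset (Finset.range (2 ^ (k + κ))) hκ).expect fun c =>
      G e (complete h m (c : ZMod N))]
  refine PMF.expect_le_expect_add _ fun w => ?_
  let F : ℕ → ℝ≥0∞ := fun c => G (corruptPart C w) (complete h (maskSharing x.1 v w) (c : ZMod N))
  refine (expect_bitSum_add_uniform (Nat.sub_le k 1) hl fun i => F (i + shiftedInput x)).trans_le ?_
  rw [hexp, PMF.expect_uniformOfFinset, Finset.card_range]
  push_cast
  refine (mul_le_mul_right (sum_range_shift_le _ (shiftedInput x) F fun i => hG _ _) _).trans ?_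
  rw [mul_add]
  refine add_le_add_right ?_ _
  have hy : (shiftedInput x : ℝ≥0∞) ≤ 2 ^ k := by
    exact_mod_cast (shiftedInput_lt hk x).le
  refine (mul_le_mul_right hy _).trans_eq ?_
  rw [pow_add, ENNReal.mul_inv (by simp) (by simp), mul_right_comm,
    ENNReal.inv_mul_cancel (by simp) (by simp), one_mul, ENNReal.ofReal_pow (by norm_num),
    ENNReal.ofReal_inv_of_pos two_pos, ENNReal.inv_pow]
  simp

omit [NeZero n] [NeZero N] in
lemma corruptPart_contributed {C : Finset (Fin n)} (v : Sharing n N) (e : CorruptShares N C) :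
    corruptPart C (contributed v e) = e := by
  ext i
  simp [corruptPart, contributed]

omit [NeZero N] in
/-- The shares of the corrupted parties of the comparison bit, computed from their output. -/
lemma sub_outSharing_of_corruptPart_eq (hN : Odd N) {C : Finset (Fin n)} {x x' : Sharing n N}
    {v r : Fin k → Sharing n N} (hx : corruptPart C x' = corruptPart C x)
    (hv : ∀ j, corruptPart C (v j) = corruptPart C (r j)) (c : ZMod N) (u : Sharing n N) :
    (fun i : {i // i ∈ C} => outSharing x' v c 0 i - corruptPart C (outSharing x r c u) i) =
      corruptPart C u := by
  ext i
  have hxi : x' i = x i := congrFun hx i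
  have hvi : ∀ j, v j i = r j i := fun j => congrFun (hv j) i
  rw [outSharing_eq_sub hN x r c u]
  simp [corruptPart, outSharing, hxi, hvi]

/-- The environment port of the hybrid world. -/
def hybridEnv (κ k : ℕ) (C : Finset (Fin n)) :
    HybridState n N k → PartyIn n N k → PMF (PartyOut N C × HybridState n N k) :=
  (hybridWorld κ k C).env

/-- The adversary port of the hybrid world. -/
def hybridStep (κ k : ℕ) (C : Finset (Fin n)) :
    HybridState n N k → HybridMsg N k C → PMF (HybridReply N k C × HybridState n N k) :=
  (hybridWorld κ k C).adv

/-- The environment port of the ideal world. -/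
def idealEnv (k : ℕ) (C : Finset (Fin n)) :
    IdealState n N k → PartyIn n N k → PMF (PartyOut N C × IdealState n N k) :=
  (idealWorld k C).env

/-- The adversary port of the ideal world. -/
def idealStep (k : ℕ) (C : Finset (Fin n)) :
    IdealState n N k → IdealMsg N C → PMF (IdealReply N C × IdealState n N k) :=
  (idealWorld k C).adv

/-- Related states answer the environment identically, and only an input to idle parties changes
them. -/
lemma GEZSimulates.env_le {C : Finset (Fin n)} {h : Fin n} {ε δ : ℝ≥0∞}
    {t : TranslatorState n N k} {s : IdealState n N k} {μ : PMF (HybridState n N k)}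
    (hR : GEZSimulates ε C h t s μ δ) (q : PartyIn n N k)
    (g : PartyOut N C × HybridState n N k → ℝ≥0∞)
    (g' : PartyOut N C × TranslatorState n N k × IdealState n N k → ℝ≥0∞)
    (hg : ∀ x t' s' μ' δ', GEZSimulates ε C h t' s' μ' δ' →
      μ'.expect (fun w => g (x, w)) ≤ g' (x, t', s') + δ') :
    μ.expect (fun w => (hybridEnv κ k C w q).expect g) ≤
      (idealEnv k C s q).expect (fun z => g' (z.1, t, z.2)) + δ := by
  cases hR with
  | finished s =>
    cases q <;>
      simpa [hybridEnv, idealEnv, hybridWorld, idealWorld] using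
        hg _ _ _ _ _ (.finished s)
  | idle =>
    cases q with
    | input x => simpa [hybridEnv, idealEnv, hybridWorld, idealWorld] using hg _ _ _ _ _ (.ready x)
    | readOutput => simpa [hybridEnv, idealEnv, hybridWorld, idealWorld] using hg _ _ _ _ _ .idle
  | ready x =>
    cases q <;>
      simpa [hybridEnv, idealEnv, hybridWorld, idealWorld] using
        hg _ _ _ _ _ (.ready x)
  | bits x x' v hx =>
    cases q <;>
      simpa [hybridEnv, idealEnv, hybridWorld, idealWorld] using
        hg _ _ _ _ _ (.bits x x' v hx)
  | masked x x' v r r'' hx hv hs =>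
    cases q <;>
      simpa [hybridEnv, idealEnv, hybridWorld, idealWorld] using
        hg _ _ _ _ _ (.masked x x' v r r'' hx hv hs)
  | opening x x' v r r'' hx hv hs =>
    cases q <;>
      simpa [hybridEnv, idealEnv, hybridWorld, idealWorld] using
        hg _ _ _ _ _ (.opening x x' v r r'' hx hv hs)
  | opened x x' v r c hx hv hs =>
    cases q <;>
      simpa [hybridEnv, idealEnv, hybridWorld, idealWorld] using
        hg _ _ _ _ _ (.opened x x' v r c hx hv hs)
  | compared x r c u =>
    cases q <;>
      simpa [hybridEnv, idealEnv, hybridWorld, idealWorld] using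
        hg _ _ _ _ _ (.compared x r c u)
  | aborted =>
    cases q <;>
      simpa [hybridEnv, idealEnv, hybridWorld, idealWorld] using
        hg _ _ _ _ _ .aborted

set_option maxHeartbeats 1000000 in
-- Only `callPRndInt` spends the error; every other message is simulated exactly.
lemma GEZSimulates.adv_le (hN : Odd N) (hk : 1 ≤ k) (hsize : 2 ^ (k + κ) + 2 ^ k ≤ N + 1)
    {C : Finset (Fin n)} {h : Fin n} (hh : h ∉ C) {ε δ : ℝ≥0∞}
    (hε : ENNReal.ofReal (2⁻¹ ^ κ) ≤ ε) {t : TranslatorState n N k} {s : IdealState n N k}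
    {μ : PMF (HybridState n N k)} (hR : GEZSimulates ε C h t s μ δ) (q : HybridMsg N k C)
    (g : HybridReply N k C × HybridState n N k → ℝ≥0∞)
    (g' : (HybridReply N k C × TranslatorState n N k) × IdealState n N k → ℝ≥0∞)
    (hg' : ∀ z, g' z ≤ 1)
    (hg : ∀ x t' s' μ' δ', GEZSimulates ε C h t' s' μ' δ' →
      μ'.expect (fun w => g (x, w)) ≤ g' ((x, t'), s') + δ') :
    μ.expect (fun w => (hybridStep κ k C w q).expect g) ≤
      ((gezTranslator κ k C h t q).run (idealStep k C) s).expect g' + δ := by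
  have haborted := hg .aborted _ _ _ _ .aborted
  have habort : ∀ δ' : ℝ≥0∞, g (.aborted, .aborted) ≤ g' ((.aborted, .aborted), .aborted) + δ' :=
    fun δ' => le_add_right (by simpa using haborted)
  cases hR with
  | finished s =>
    cases q <;>
      simpa [hybridStep, idealStep, hybridWorld, idealWorld, gezTranslator, Prog.run] using
        hg _ _ _ _ _ (.finished s)
  | idle =>
    cases q <;>
      simpa [hybridStep, idealStep, hybridWorld, idealWorld, gezTranslator, Prog.run] using
        hg _ _ _ _ _ .idle
  | ready x =>
    cases q
    case abort =>
      simpa [hybridStep, idealStep, hybridWorld, idealWorld, gezTranslator, Prog.run] using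
        habort _
    case callRndBit =>
      simp only [hybridStep, idealStep, hybridWorld, idealWorld, gezTranslator, Prog.run,
        PMF.expect_pure, PMF.expect_bind]
      rw [fRndBit_eq_bind_complete h, expect_parallel_bind]
      refine PMF.expect_le_expect_add _ fun v => ?_
      simpa [corruptPart_complete hh] using hg _ _ _ _ _
        (.bits x (contributed 0 (corruptPart C x.1)) v (corruptPart_contributed _ _))
    all_goals
      simpa [hybridStep, idealStep, hybridWorld, idealWorld, gezTranslator, Prog.run]
        using hg _ _ _ _ _ (.ready x)
  | bits x x' v hx =>
    cases q
    case abort =>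
      simpa [hybridStep, idealStep, hybridWorld, idealWorld, gezTranslator, Prog.run] using
        habort _
    case callPRndInt =>
      simp only [hybridStep, idealStep, hybridWorld, gezTranslator, Prog.run,
        PMF.expect_pure, PMF.expect_bind, PMF.expect_map]
      -- The intermediate term feeds the true masked sharing to the translator: reaching it uses the
      -- relation pointwise on the support, leaving it costs the statistical error.
      refine le_trans ?_ ((expect_mask_le (κ := κ) hN hk hh x hx v ⟨0, by simp⟩
        (fun e m => g' ((.shares e, .masked x' v m), .ready x)) fun e m => hg' _).trans ?_)
      · refine PMF.expect_mono _ fun b => PMF.expect_mono_support _ fun r'' hr'' => ?_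
        obtain ⟨ρ, hρ, hr''⟩ := exists_of_mem_support_fPRndInt hr''
        simpa using hg _ _ _ _ _ (.masked x x' v
          (fun j => complete h (v j) (if b j then 1 else 0)) r'' hx
          (fun j => (corruptPart_complete hh _ _).symm)
          (outSharing_sub_comparisonBit hN hk hsize x (fun j => reconstruct_complete _ _ _) hρ
            (reconstruct_maskSharing_of_bits x (fun j => reconstruct_complete _ _ _) hr'')))
      · exact add_le_add_right hε _
    all_goals
      simpa [hybridStep, idealStep, hybridWorld, idealWorld, gezTranslator, Prog.run]
        using hg _ _ _ _ _ (.bits x x' v hx)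
  | masked x x' v r r'' hx hv hs =>
    cases q
    case abort =>
      simpa [hybridStep, idealStep, hybridWorld, idealWorld, gezTranslator, Prog.run] using
        habort 0
    case openMask =>
      simpa [hybridStep, idealStep, hybridWorld, idealWorld, gezTranslator, Prog.run] using
      hg _ _ _ _ _ (.opening x x' v r r'' hx hv hs)
    all_goals
      simpa [hybridStep, idealStep, hybridWorld, idealWorld, gezTranslator, Prog.run]
        using hg _ _ _ _ _ (.masked x x' v r r'' hx hv hs)
  | opening x x' v r r'' hx hv hs =>
    cases q
    case abort =>
      simpa [hybridStep, idealStep, hybridWorld, idealWorld, gezTranslator, Prog.run] using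
        habort 0
    case publish e =>
      by_cases he : authentic (maskSharing x.1 r r'') e
      · have hc : reconstruct (contributed (maskSharing x.1 r r'') e) = _ := he
        simpa [hybridStep, idealStep, hybridWorld, gezTranslator, Prog.run, he, hc] using
          hg _ _ _ _ _ (.opened x x' v r _ hx hv hs)
      · simpa [hybridStep, idealStep, hybridWorld, idealWorld, gezTranslator, Prog.run, he] using
          habort 0
    all_goals
      simpa [hybridStep, idealStep, hybridWorld, idealWorld, gezTranslator, Prog.run]
        using hg _ _ _ _ _ (.opening x x' v r r'' hx hv hs)
  | opened x x' v r c hx hv hs =>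
    cases q
    case abort =>
      simpa [hybridStep, idealStep, hybridWorld, idealWorld, gezTranslator, Prog.run] using
        habort 0
    case callBitLTC e =>
      have hiff : (∀ j, authentic (lowBits v j) (e j)) ↔ ∀ j, authentic (lowBits r j) (e j) :=
        forall_congr' fun j => authentic_congr (hv _) (e j)
      by_cases he : ∀ j, authentic (lowBits r j) (e j)
      · have hu : fBitLTC (lowPart k c) (fun j => contributed (lowBits r j) (e j)) =
            share (comparisonBit r c) := by
          have he' : ∀ j, reconstruct (contributed (lowBits r j) (e j)) = _ := he
          simp only [fBitLTC, comparisonBit, he']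
        -- This couples the worlds: the ideal output is drawn as the image of a fresh comparison
        -- sharing `u`, the same `u` as in the protocol.
        have hF : fGEZ x.1 = (share (comparisonBit r c)).map (outSharing x.1 r c) := by
          rw [map_outSharing_share hN, hs]
          rfl
        simp only [hybridStep, idealStep, hybridWorld, idealWorld, gezTranslator, Prog.run, he, hx,
          hiff, implies_true, if_true, PMF.expect_pure, PMF.expect_bind, authentic_corruptPart,
          contributed_corruptPart, hu, hF, PMF.expect_map, add_zero]
        refine PMF.expect_mono _ fun u => ?_
        simpa [sub_outSharing_of_corruptPart_eq hN hx hv] using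
          hg (.shares (corruptPart C u)) _ _ _ _ (.compared x r c u)
      · simpa [hybridStep, idealStep, hybridWorld, idealWorld, gezTranslator, Prog.run, hiff, he]
          using habort 0
    all_goals
      simpa [hybridStep, idealStep, hybridWorld, idealWorld, gezTranslator, Prog.run]
        using hg _ _ _ _ _ (.opened x x' v r c hx hv hs)
  | compared x r c u =>
    cases q
    case abort =>
      simpa [hybridStep, idealStep, hybridWorld, idealWorld, gezTranslator, Prog.run] using
        habort 0
    case deliver =>
      simpa [hybridStep, idealStep, hybridWorld, idealWorld, gezTranslator, Prog.run] using
      hg _ _ _ _ _ (.finished (outSharing x.1 r c u))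
    all_goals
      simpa [hybridStep, idealStep, hybridWorld, idealWorld, gezTranslator, Prog.run]
        using hg _ _ _ _ _ (.compared x r c u)
  | aborted =>
    cases q <;>
      simpa [hybridStep, idealStep, hybridWorld, idealWorld, gezTranslator, Prog.run] using
        hg _ _ _ _ _ .aborted

/-- Security of the comparison protocol. -/
theorem ucRealizes_gez (hN : Odd N) (hk : 1 ≤ k) (hsize : 2 ^ (k + κ) + 2 ^ k ≤ N + 1)
    {C : Finset (Fin n)} (hC : C ≠ Finset.univ) :
    UCRealizes (hybridWorld (N := N) κ k C) (idealWorld (N := N) k C) ((2 : ℝ)⁻¹ ^ κ) := by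
  obtain ⟨h, hh⟩ : ∃ h, h ∉ C := by
    by_contra! hall
    exact hC (Finset.eq_univ_iff_forall.2 hall)
  have H : ApproxSimulation (hybridWorld (N := N) κ k C) (idealWorld (N := N) k C)
      (gezTranslator κ k C h) (GEZSimulates (ENNReal.ofReal (2⁻¹ ^ κ)) C h) :=
    { env := fun hR q g g' hg => hR.env_le q g g' hg
      adv := fun hR q g g' hg' hg => hR.adv_le hN hk hsize hh le_rfl q g g' hg' hg }
  exact H.ucRealizes (by positivity) .idle

end Security

lemma IsRSAModulus.odd {N : ℕ} (hN : IsRSAModulus N) : Odd N := by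
  obtain ⟨p, q, -, -, -, hp, hq, rfl⟩ := hN
  exact hp.mul hq

end

theorem mainTheorem9 (n N k κ : ℕ) [NeZero n] [NeZero N] (hN : IsRSAModulus N) (hk : 1 ≤ k)
    (hsize : 2 ^ (k + κ) + 2 ^ k ≤ N + 1) :
    (∀ x : SignedSharing n N k, gezProtocol κ k x.1 = fGEZ x.1) ∧
    (∀ C : Finset (Fin n), C ≠ Finset.univ →
      UCRealizes (hybridWorld (N := N) κ k C) (idealWorld (N := N) k C) ((2 : ℝ)⁻¹ ^ κ)) :=
  ⟨gezProtocol_eq_fGEZ hN.odd hk hsize, fun _ hC => ucRealizes_gez hN.odd hk hsize hC⟩
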